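/- Let $q,\rho\in(-1,1)$, $S(q)=\left[-2/\sqrt{1-q},\,2/\sqrt{1-q}\right]$ and $y\in S(q)$. Put $[n]_q=1+q+\dots+q^{n-1}$ (so $[0]_q=0$), $[n]_q!=\prod_{i=1}^n[i]_q$, $(a)_n=\prod_{i=0}^{n-1}(1-aq^i)$, $(a)_\infty=\prod_{i=0}^{\infty}(1-aq^i)$, with the convention $0^0=1$. Define, for $x$ in the interior of $S(q)$, $$f_N(x|q)=\frac{\sqrt{1-q}\,(q)_\infty}{2\pi\sqrt{4-(1-q)x^2}}\prod_{k=0}^\infty\left((1+q^k)^2-(1-q)x^2q^k\right),$$ $$f_{CN}(x|y,\rho,q)=\frac{\sqrt{1-q}\,(\rho^2)_\infty(q)_\infty}{2\pi\sqrt{4-(1-q)x^2}}\prod_{k=0}^\infty\frac{(1+q^k)^2-(1-q)x^2q^k}{(1-\rho^2q^{2k})^2-(1-q)\rho q^k(1+\rho^2q^{2k})xy+(1-q)\rho^2(x^2+y^2)q^{2k}},$$ and let both functions be $0$ (their continuous extension) at the two endpoints of $S(q)$. Define polynomials by $H_{-1}=P_{-1}=B_{-1}=0$, $H_0=P_0=B_0=1$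 and, for $n\ge 0$ (the terms with factor $[0]_q$ being $0$), $$H_{n+1}(x|q)=xH_n(x|q)-[n]_qH_{n-1}(x|q),$$ $$P_{n+1}(x|y,\rho,q)=(x-\rho yq^n)P_n(x|y,\rho,q)-(1-\rho^2q^{n-1})[n]_qP_{n-1}(x|y,\rho,q),$$ $$B_{n+1}(y|q)=-q^nyB_n(y|q)+q^{n-1}[n]_qB_{n-1}(y|q).$$ Then for every $x\in S(q)$ the two series below converge absolutely, and $$f_{CN}(x|y,\rho,q)=f_N(x|q)\sum_{n=0}^\infty\frac{\rho^n}{[n]_q!}H_n(y|q)H_n(x|q),$$ $$f_N(x|q)=f_{CN}(x|y,\rho,q)\sum_{n=0}^\infty\frac{\rho^n}{(\rho^2)_n[n]_q!}B_n(y|q)P_n(x|y,\rho,q);$$ moreover the two series are reciprocal to each other, i.e. the product of their sums is $1$ for every $x\in S(q)$. The function $f_{CN}/f_N$ belongs to $L^2(S(q),f_N(x|q)\,dx)$ and the first series converges to it in that space; the function $f_N/f_{CN}$ belongs to $L^2(S(q),f_{CN}(x|y,\rho,q)\,dx)$ and the second series converges to it in that space. -/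

import Mathlib

open MeasureTheory Filter Topology

noncomputable section

namespace QSeries

/-- The `q`-integer `[n]_q = 1 + q + ⋯ + q^(n-1)`. -/
def qInt (q : ℝ) (n : ℕ) : ℝ := ∑ i ∈ Finset.range n, q ^ i

/-- The `q`-factorial `[n]_q! = [1]_q [2]_q ⋯ [n]_q`. -/
def qFactorial (q : ℝ) (n : ℕ) : ℝ := ∏ i ∈ Finset.range n, qInt q (i + 1)

/-- The finite `q`-Pochhammer symbol `(a; q)_n`. -/
def qPoch (a q : ℝ) (n : ℕ) : ℝ := ∏ i ∈ Finset.range n, (1 - a * q ^ i)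

/-- The infinite `q`-Pochhammer symbol `(a; q)_∞`. -/
def qPochInf (a q : ℝ) : ℝ := ∏' i : ℕ, (1 - a * q ^ i)

/-- The interval `S(q) = [-2/√(1-q), 2/√(1-q)]`. -/
def S (q : ℝ) : Set ℝ := Set.Icc (-2 / √(1 - q)) (2 / √(1 - q))

/-- The `q`-Normal density `f_N(x|q)` on `S(q)`. At the two endpoints of `S(q)` its value is `0`. -/
def fN (q x : ℝ) : ℝ :=
  √(1 - q) * qPochInf q q / (2 * Real.pi * √(4 - (1 - q) * x ^ 2)) *
    ∏' k : ℕ, ((1 + q ^ k) ^ 2 - (1 - q) * x ^ 2 * q ^ k)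

/-- The conditional `q`-Normal density `f_CN(x|y,ρ,q)` on `S(q)`.
At the two endpoints of `S(q)` its value is `0`. -/
def fCN (q ρ y x : ℝ) : ℝ :=
  √(1 - q) * (qPochInf (ρ ^ 2) q * qPochInf q q) /
      (2 * Real.pi * √(4 - (1 - q) * x ^ 2)) *
    ∏' k : ℕ, ((1 + q ^ k) ^ 2 - (1 - q) * x ^ 2 * q ^ k) /
      ((1 - ρ ^ 2 * q ^ (2 * k)) ^ 2
        - (1 - q) * ρ * q ^ k * (1 + ρ ^ 2 * q ^ (2 * k)) * x * y
        + (1 - q) * ρ ^ 2 * (x ^ 2 + y ^ 2) * q ^ (2 * k))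

/-- The `q`-Hermite polynomials: `H_{n+1} = x H_n - [n]_q H_{n-1}`, `H_{-1} = 0`, `H_0 = 1`. -/
def H (q x : ℝ) : ℕ → ℝ
  | 0 => 1
  | 1 => x
  | n + 2 => x * H q x (n + 1) - qInt q (n + 1) * H q x n

/-- The Al-Salam–Chihara polynomials:
`P_{n+1} = (x - ρ y q^n) P_n - (1 - ρ² q^(n-1)) [n]_q P_{n-1}`, `P_{-1} = 0`, `P_0 = 1`. -/
def P (q ρ y x : ℝ) : ℕ → ℝ
  | 0 => 1
  | 1 => x - ρ * y
  | n + 2 => (x - ρ * y * q ^ (n + 1)) * P q ρ y x (n + 1)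
      - (1 - ρ ^ 2 * q ^ n) * qInt q (n + 1) * P q ρ y x n

/-- The auxiliary polynomials:
`B_{n+1} = -q^n y B_n + q^(n-1) [n]_q B_{n-1}`, `B_{-1} = 0`, `B_0 = 1`. -/
def B (q y : ℝ) : ℕ → ℝ
  | 0 => 1
  | 1 => -y
  | n + 2 => -q ^ (n + 1) * y * B q y (n + 1) + q ^ n * qInt q (n + 1) * B q y n

/-- The measure on `S(q)` with Lebesgue density `f_N(·|q)`. -/
def measureN (q : ℝ) : Measure ℝ :=
  (volume.restrict (S q)).withDensity fun x => ENNReal.ofReal (fN q x)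

/-- The measure on `S(q)` with Lebesgue density `f_CN(·|y,ρ,q)`. -/
def measureCN (q ρ y : ℝ) : Measure ℝ :=
  (volume.restrict (S q)).withDensity fun x => ENNReal.ofReal (fCN q ρ y x)

/-- The `n`-th term of the Poisson–Mehler series. -/
def mehlerTerm (q ρ y x : ℝ) (n : ℕ) : ℝ :=
  ρ ^ n / qFactorial q n * H q y n * H q x n

/-- The `n`-th term of the reciprocal series. -/
def reciprocalTerm (q ρ y x : ℝ) (n : ℕ) : ℝ :=
  ρ ^ n / (qPoch (ρ ^ 2) q n * qFactorial q n) * B q y n * P q ρ y x n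

end QSeries

end

/-!
Put `X = √(1 - q) x` and `Y = √(1 - q) y`, so that `|X|, |Y| ≤ 2`, and let `M(r)` and `R(r)` be the
sums of the Poisson–Mehler series and of the reciprocal series with `ρ` replaced by `r`. With
`w(r) = (1 - r²)² - r(1 + r²)XY + r²(X² + Y²)` the quotient of the two densities is
`f_CN / f_N = (ρ²)_∞ / ∏ w(ρ q^k)`, so that everything rests on the product formulas
`∏ w(r q^k) * M(r) = (r²)_∞` and `(r²)_∞ * R(r) = ∏ w(r q^k)`.

Both products come from first-order `q`-difference equations,
`w(r) M(r) = (1 - r²)(1 - r² q) M(q r)` and `w(r) R(q r) = (1 - r²)(1 - r² q) R(r)`,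
iterated down to `r = 0`, where both series equal `1`. The equation for `M`
(`quartic_mul_tsum_kernelTerm`) compares coefficients of powers of `r` and is the five-term
recurrence satisfied by the products `H_n(x) H_n(y)`. In the series `R` the polynomials depend on
`r` too; there `w(r) P_n(· | q r)` is a combination of `P_{n+2}`, `P_{n+1}`, `P_n` at the parameter
`r` (`quartic_mul_chihara`), and the recurrence of `B_n` makes the difference of the two sides
telescope (`sum_range_quartic_mul_dualTerm`).

The analytic input is that the rescaled `H_n` and `P_n` grow at most linearly in `n`, uniformly for
`|X|, |Y| ≤ 2` (`abs_le_of_perturbed_chebyshev`), while the rescaled `B_n` and the reciprocals of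
the `q`-Pochhammer symbols stay bounded. Hence both series are dominated on `S(q)` by a convergent
series of constants. Since the densities are bounded, the two measures are finite and mean square
convergence follows from uniform convergence; no orthogonality is needed.
-/

namespace QSeries

/-! ### Normalised polynomials -/

/-- The continuous `q`-Hermite polynomials in the variable `X = 2 cos θ`; this is `H` rescaled by
`X = √(1 - q) x`, which replaces `[n]_q` by `1 - q ^ n`. -/
def hermite (q X : ℝ) : ℕ → ℝ
  | 0 => 1
  | 1 => X
  | n + 2 => X * hermite q X (n + 1) - (1 - q ^ (n + 1)) * hermite q X n

/-- The Al-Salam–Chihara polynomials `P` in the rescaled variables `X = √(1 - q) x` and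
`Y = √(1 - q) y`. -/
def chihara (q r X Y : ℝ) : ℕ → ℝ
  | 0 => 1
  | 1 => X - r * Y
  | n + 2 => (X - r * Y * q ^ (n + 1)) * chihara q r X Y (n + 1)
      - (1 - r ^ 2 * q ^ n) * (1 - q ^ (n + 1)) * chihara q r X Y n

/-- The polynomials `B` in the rescaled variable `Y = √(1 - q) y`. -/
def dualHermite (q Y : ℝ) : ℕ → ℝ
  | 0 => 1
  | 1 => -Y
  | n + 2 => -q ^ (n + 1) * Y * dualHermite q Y (n + 1)
      + q ^ n * (1 - q ^ (n + 1)) * dualHermite q Y n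

/-- The `n`-th term of the Poisson–Mehler series in rescaled variables. -/
noncomputable def kernelTerm (q r X Y : ℝ) (n : ℕ) : ℝ :=
  r ^ n / qPoch q q n * hermite q Y n * hermite q X n

/-- The coefficient of the `n`-th Al-Salam–Chihara polynomial in the reciprocal series, in
rescaled variables. -/
noncomputable def dualCoeff (q r Y : ℝ) (n : ℕ) : ℝ :=
  r ^ n / (qPoch (r ^ 2) q n * qPoch q q n) * dualHermite q Y n

/-- The `n`-th term of the reciprocal series in rescaled variables. -/
noncomputable def dualTerm (q r X Y : ℝ) (n : ℕ) : ℝ := dualCoeff q r Y n * chihara q r X Y n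

/-- The quartic `∏ (1 - r exp(i(±θ±φ)))`, over the four choices of signs, for `X = 2 cos θ` and
`Y = 2 cos φ`. -/
def quartic (r X Y : ℝ) : ℝ :=
  (1 - r ^ 2) ^ 2 - r * (1 + r ^ 2) * X * Y + r ^ 2 * (X ^ 2 + Y ^ 2)

theorem one_sub_mul_qInt (q : ℝ) (n : ℕ) : (1 - q) * qInt q n = 1 - q ^ n :=
  mul_neg_geom_sum q n

theorem qPoch_zero (a q : ℝ) : qPoch a q 0 = 1 := by simp [qPoch]

theorem qPoch_succ (a q : ℝ) (n : ℕ) : qPoch a q (n + 1) = qPoch a q n * (1 - a * q ^ n) :=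
  Finset.prod_range_succ _ _

theorem qPoch_add_two (r q : ℝ) (n : ℕ) :
    qPoch (r ^ 2) q (n + 2) = (1 - r ^ 2) * (1 - r ^ 2 * q) * qPoch ((q * r) ^ 2) q n := by
  unfold qPoch
  rw [Finset.prod_range_succ', Finset.prod_range_succ']
  have : ∀ i, 1 - (q * r) ^ 2 * q ^ i = 1 - r ^ 2 * q ^ (i + 1 + 1) := fun i => by ring
  simp only [this, pow_zero, zero_add, pow_one]
  ring

theorem qFactorial_mul_pow (q : ℝ) (n : ℕ) :
    qFactorial q n * (1 - q) ^ n = qPoch q q n := by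
  unfold qFactorial qPoch
  have h := Finset.prod_mul_pow_card (s := Finset.range n) (f := fun i => qInt q (i + 1))
    (b := 1 - q)
  rw [Finset.card_range] at h
  rw [h]
  refine Finset.prod_congr rfl fun i _ => ?_
  rw [mul_comm, one_sub_mul_qInt, pow_succ']

theorem hermite_mul {q s : ℝ} (hs : s ^ 2 = 1 - q) (x : ℝ) (n : ℕ) :
    hermite q (s * x) n = s ^ n * H q x n := by
  induction n using Nat.twoStepInduction with
  | zero => simp [hermite, H]
  | one => simp [hermite, H]
  | more n h0 h1 =>
    rw [hermite, H, h0, h1, ← one_sub_mul_qInt, ← hs]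
    ring

theorem chihara_mul {q s : ℝ} (hs : s ^ 2 = 1 - q) (r x y : ℝ) (n : ℕ) :
    chihara q r (s * x) (s * y) n = s ^ n * P q r y x n := by
  induction n using Nat.twoStepInduction with
  | zero => simp [chihara, P]
  | one => simp only [chihara, P]; ring
  | more n h0 h1 =>
    rw [chihara, P, h0, h1, ← one_sub_mul_qInt, ← hs]
    ring

theorem dualHermite_mul {q s : ℝ} (hs : s ^ 2 = 1 - q) (y : ℝ) (n : ℕ) :
    dualHermite q (s * y) n = s ^ n * B q y n := by
  induction n using Nat.twoStepInduction with
  | zero => simp [dualHermite, B]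
  | one => simp [dualHermite, B]
  | more n h0 h1 =>
    rw [dualHermite, B, h0, h1, ← one_sub_mul_qInt, ← hs]
    ring

theorem mehlerTerm_eq {q s : ℝ} (hs : s ^ 2 = 1 - q) (hs0 : s ≠ 0) (r y x : ℝ) :
    mehlerTerm q r y x = kernelTerm q r (s * x) (s * y) := by
  ext n
  rw [mehlerTerm, kernelTerm, hermite_mul hs, hermite_mul hs, ← qFactorial_mul_pow, ← hs,
    ← pow_mul, mul_comm 2 n, pow_mul]
  field_simp

theorem reciprocalTerm_eq {q s : ℝ} (hs : s ^ 2 = 1 - q) (hs0 : s ≠ 0) (r y x : ℝ) :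
    reciprocalTerm q r y x = dualTerm q r (s * x) (s * y) := by
  ext n
  rw [reciprocalTerm, dualTerm, dualCoeff, chihara_mul hs, dualHermite_mul hs,
    ← qFactorial_mul_pow, ← hs, ← pow_mul, mul_comm 2 n, pow_mul]
  field_simp

/-! ### Algebraic identities behind the functional equations -/

/-- Products of two solutions of three-term recurrences satisfy a five-term recurrence. -/
theorem hermite_mul_hermite_recurrence (q X Y : ℝ) (n : ℕ) :
    hermite q Y (n + 4) * hermite q X (n + 4)
      - X * Y * (hermite q Y (n + 3) * hermite q X (n + 3))
      + (X ^ 2 + Y ^ 2 - 2 + (1 + q) * q ^ (n + 2)) * (1 - q ^ (n + 3))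
        * (hermite q Y (n + 2) * hermite q X (n + 2))
      - X * Y * (1 - q ^ (n + 3)) * (1 - q ^ (n + 2))
        * (hermite q Y (n + 1) * hermite q X (n + 1))
      + (1 - q ^ (n + 1)) ^ 2 * (1 - q ^ (n + 2)) * (1 - q ^ (n + 3))
        * (hermite q Y n * hermite q X n) = 0 := by
  simp only [hermite]
  ring

/-- Multiplication by the quartic, of degree two in `X`, turns the orthogonality weight for the
parameter `r` into a multiple of the one for `q * r`; this is the resulting three-term connection
between the two families. -/
theorem quartic_mul_chihara (q r X Y : ℝ) (n : ℕ) :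
    quartic r X Y * chihara q (q * r) X Y n =
      r ^ 2 * chihara q r X Y (n + 2)
        - r * Y * (1 - r ^ 2 * q ^ (n + 1)) * chihara q r X Y (n + 1)
        + (1 - r ^ 2 * q ^ n) * (1 - r ^ 2 * q ^ (n + 1)) * chihara q r X Y n := by
  induction n using Nat.twoStepInduction with
  | zero => simp only [quartic, chihara]; ring
  | one => simp only [quartic, chihara]; ring
  | more n h0 h1 =>
    have e : quartic r X Y * chihara q (q * r) X Y (n + 2) =
        (X - q * r * Y * q ^ (n + 1)) * (quartic r X Y * chihara q (q * r) X Y (n + 1))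
        - (1 - (q * r) ^ 2 * q ^ n) * (1 - q ^ (n + 1))
          * (quartic r X Y * chihara q (q * r) X Y n) := by
      rw [chihara]; ring
    rw [e, h0, h1]
    simp only [chihara]
    ring

theorem kernelTerm_mul_left (q r X Y : ℝ) (n : ℕ) :
    kernelTerm q (q * r) X Y n = q ^ n * kernelTerm q r X Y n := by
  unfold kernelTerm
  rw [mul_pow]; ring

theorem kernelTerm_recurrence {q : ℝ} (hP : ∀ n, qPoch q q n ≠ 0) (r X Y : ℝ) (n : ℕ) :
    kernelTerm q r X Y (n + 4) - X * Y * r * kernelTerm q r X Y (n + 3)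
      + (X ^ 2 + Y ^ 2 - 2) * r ^ 2 * kernelTerm q r X Y (n + 2)
      - X * Y * r ^ 3 * kernelTerm q r X Y (n + 1) + r ^ 4 * kernelTerm q r X Y n =
    kernelTerm q (q * r) X Y (n + 4) - (1 + q) * r ^ 2 * kernelTerm q (q * r) X Y (n + 2)
      + q * r ^ 4 * kernelTerm q (q * r) X Y n := by
  have key : ∀ k, (qPoch q q k)⁻¹ = (qPoch q q (k + 1))⁻¹ * (1 - q ^ (k + 1)) := by
    intro k
    have h1 := hP k
    have h2 := hP (k + 1)
    have h3 : qPoch q q (k + 1) = qPoch q q k * (1 - q ^ (k + 1)) := by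
      rw [qPoch_succ, pow_succ' q k]
    rw [eq_inv_mul_iff_mul_eq₀ h2, h3]
    field_simp
  have k0 := key n
  have k1 : (qPoch q q (n + 1))⁻¹ = (qPoch q q (n + 2))⁻¹ * (1 - q ^ (n + 2)) := key _
  have k2 : (qPoch q q (n + 2))⁻¹ = (qPoch q q (n + 3))⁻¹ * (1 - q ^ (n + 3)) := key _
  have k3 : (qPoch q q (n + 3))⁻¹ = (qPoch q q (n + 4))⁻¹ * (1 - q ^ (n + 4)) := key _
  simp only [kernelTerm_mul_left]
  simp only [kernelTerm, div_eq_mul_inv, k0, k1, k2, k3]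
  linear_combination (r ^ (n + 4) * (qPoch q q (n + 4))⁻¹) * (1 - q ^ (n + 4)) *
    hermite_mul_hermite_recurrence q X Y n

/-- The `q`-difference equation of the Poisson–Mehler kernel. -/
theorem quartic_mul_tsum_kernelTerm {q : ℝ} (hP : ∀ n, qPoch q q n ≠ 0) {r X Y : ℝ}
    (h : Summable (kernelTerm q r X Y)) (h' : Summable (kernelTerm q (q * r) X Y)) :
    quartic r X Y * ∑' n, kernelTerm q r X Y n =
      (1 - r ^ 2) * (1 - r ^ 2 * q) * ∑' n, kernelTerm q (q * r) X Y n := by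
  set f := kernelTerm q r X Y with hf
  set g := kernelTerm q (q * r) X Y with hg
  have sf : ∀ k, Summable fun n => f (n + k) := fun k => (summable_nat_add_iff k).2 h
  have sg : ∀ k, Summable fun n => g (n + k) := fun k => (summable_nat_add_iff k).2 h'
  have tail : (∑' n, f (n + 4)) - X * Y * r * (∑' n, f (n + 3))
      + (X ^ 2 + Y ^ 2 - 2) * r ^ 2 * (∑' n, f (n + 2))
      - X * Y * r ^ 3 * (∑' n, f (n + 1)) + r ^ 4 * (∑' n, f n) =
    (∑' n, g (n + 4)) - (1 + q) * r ^ 2 * (∑' n, g (n + 2)) + q * r ^ 4 * (∑' n, g n) := by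
    have e1 := (((((sf 4).hasSum.sub ((sf 3).hasSum.mul_left (X * Y * r))).add
      ((sf 2).hasSum.mul_left ((X ^ 2 + Y ^ 2 - 2) * r ^ 2))).sub
      ((sf 1).hasSum.mul_left (X * Y * r ^ 3))).add (h.hasSum.mul_left (r ^ 4)))
    have e2 := (((sg 4).hasSum.sub ((sg 2).hasSum.mul_left ((1 + q) * r ^ 2))).add
      (h'.hasSum.mul_left (q * r ^ 4)))
    refine e1.unique ?_
    convert e2 using 2 with n
    exact kernelTerm_recurrence hP r X Y n
  have f1 := h.sum_add_tsum_nat_add 1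
  have f2 := h.sum_add_tsum_nat_add 2
  have f3 := h.sum_add_tsum_nat_add 3
  have f4 := h.sum_add_tsum_nat_add 4
  have g2 := h'.sum_add_tsum_nat_add 2
  have g4 := h'.sum_add_tsum_nat_add 4
  simp only [Finset.sum_range_succ, Finset.sum_range_zero, zero_add] at f1 f2 f3 f4 g2 g4
  -- The terms of order at most three, which the shifted recurrence does not reach.
  have head : (f 0 + f 1 + f 2 + f 3) - X * Y * r * (f 0 + f 1 + f 2)
      + (X ^ 2 + Y ^ 2 - 2) * r ^ 2 * (f 0 + f 1) - X * Y * r ^ 3 * f 0 =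
      (g 0 + g 1 + g 2 + g 3) - (1 + q) * r ^ 2 * (g 0 + g 1) := by
    have p1 := hP 1
    have p2 := hP 2
    have p3 := hP 3
    simp only [qPoch, Finset.prod_range_succ, Finset.prod_range_zero, one_mul, pow_zero,
      mul_one, pow_one] at p1 p2 p3
    simp only [hf, hg, kernelTerm_mul_left]
    simp only [kernelTerm, hermite, qPoch, Finset.prod_range_succ, Finset.prod_range_zero]
    have n1 : 1 - q ≠ 0 := p1
    have n2 : 1 - q ^ 2 ≠ 0 := by
      rw [pow_succ', pow_one]
      exact right_ne_zero_of_mul p2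
    have n3 : 1 - q ^ 3 ≠ 0 := by
      rw [pow_succ']
      exact right_ne_zero_of_mul p3
    simp only [one_mul, pow_zero, mul_one, pow_one, zero_add, ← pow_succ', ← sq]
    field_simp
    ring
  unfold quartic
  linear_combination tail + head - f4 + X * Y * r * f3 - (X ^ 2 + Y ^ 2 - 2) * r ^ 2 * f2
    + X * Y * r ^ 3 * f1 + g4 - (1 + q) * r ^ 2 * g2

/-- Telescoped form of the `q`-difference equation for the reciprocal series. -/
theorem sum_range_quartic_mul_dualTerm {q r : ℝ} (hP : ∀ n, qPoch q q n ≠ 0)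
    (hR : ∀ n, qPoch (r ^ 2) q n ≠ 0) (X Y : ℝ) (N : ℕ) :
    ∑ n ∈ Finset.range (N + 1), (quartic r X Y * dualTerm q (q * r) X Y n
        - (1 - r ^ 2) * (1 - r ^ 2 * q) * dualTerm q r X Y n) =
      r ^ 2 * (dualCoeff q (q * r) Y N * chihara q r X Y (N + 2))
        + (1 - r ^ 2) * (1 - r ^ 2 * q) * (1 - q ^ (N + 1)) * dualTerm q r X Y (N + 1) := by
  have hv : (1 - r ^ 2) * (1 - r ^ 2 * q) ≠ 0 := by
    have := hR 2
    rwa [qPoch_add_two, qPoch_zero, mul_one] at this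
  have coeff : ∀ n, dualCoeff q (q * r) Y n = (1 - r ^ 2) * (1 - r ^ 2 * q) * (q ^ n * r ^ n
      / (qPoch (r ^ 2) q (n + 2) * qPoch q q n) * dualHermite q Y n) := by
    intro n
    rw [dualCoeff, qPoch_add_two, mul_pow q r n]
    generalize (1 - r ^ 2) * (1 - r ^ 2 * q) = v at hv ⊢
    field_simp
  have term : ∀ n, quartic r X Y * dualTerm q (q * r) X Y n = dualCoeff q (q * r) Y n *
      (r ^ 2 * chihara q r X Y (n + 2)
        - r * Y * (1 - r ^ 2 * q ^ (n + 1)) * chihara q r X Y (n + 1)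
        + (1 - r ^ 2 * q ^ n) * (1 - r ^ 2 * q ^ (n + 1)) * chihara q r X Y n) := by
    intro n
    rw [← quartic_mul_chihara, dualTerm]; ring
  have sP : ∀ n, qPoch q q (n + 1) = qPoch q q n * (1 - q ^ (n + 1)) := fun n => by
    rw [qPoch_succ, pow_succ' q n]
  have nP : ∀ n, 1 - q ^ (n + 1) ≠ 0 := fun n => right_ne_zero_of_mul (sP n ▸ hP (n + 1))
  have nR : ∀ n, 1 - r ^ 2 * q ^ n ≠ 0 := fun n =>
    right_ne_zero_of_mul (qPoch_succ (r ^ 2) q n ▸ hR (n + 1))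
  induction N with
  | zero =>
    rw [Finset.sum_range_one, term, coeff]
    have a0 := nR 0
    have a1 := nR 1
    have b0 := nP 0
    simp only [dualTerm, dualCoeff, dualHermite, qPoch, chihara, Finset.prod_range_succ,
      Finset.prod_range_zero]
    simp only [one_mul, pow_zero, mul_one, pow_one, zero_add] at *
    field_simp
    ring
  | succ N ih =>
    rw [Finset.sum_range_succ, ih, term]
    have a0 := nR N
    have a1 := nR (N + 1)
    have a2 := nR (N + 2)
    have b0 := nP N
    have b1 := nP (N + 1)
    have c0 := hP N
    have d0 := hR N
    have hF : q ^ (N + 1) = 1 - (1 - q ^ (N + 1)) := by ring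
    simp only [coeff, dualTerm]
    simp only [dualCoeff, sP, qPoch_succ (r ^ 2), dualHermite]
    generalize 1 - r ^ 2 * q ^ N = E0 at *
    generalize 1 - r ^ 2 * q ^ (N + 1) = E1 at *
    generalize 1 - r ^ 2 * q ^ (N + 2) = E2 at *
    generalize 1 - q ^ (N + 1 + 1) = F1 at *
    generalize 1 - q ^ (N + 1) = F0 at *
    rw [hF]
    field_simp
    ring

/-! ### Growth bounds -/

/-- A summable perturbation of the Chebyshev recurrence `u (n + 2) = X u (n + 1) - u n` with
`|X| ≤ 2` has solutions of at most linear growth, with a constant uniform in `X`. -/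
theorem abs_le_of_perturbed_chebyshev {X K s M : ℝ} (hX : |X| ≤ 2) (hK : 0 ≤ K) (hs0 : 0 ≤ s)
    (hs1 : s < 1) {u e d : ℕ → ℝ}
    (hu : ∀ n, u (n + 2) = X * u (n + 1) - u n + e n * u (n + 1) + d n * u n)
    (he : ∀ n, |e n| ≤ K * s ^ n) (hd : ∀ n, |d n| ≤ K * s ^ n) (hM : |u 0| + |u 1| ≤ M) (n : ℕ) :
    |u n| ≤ (n + 1) * (M * Real.exp (∑' i : ℕ, K * s ^ i * (2 * i + 3))) := by
  -- A root `a` of `z ^ 2 - X z + 1`; since `|a| = 1`, the differences `u (n + 1) - a u n` are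
  -- rotated by the unperturbed recurrence.
  obtain ⟨a, ha1, ha⟩ : ∃ a : ℂ, ‖a‖ = 1 ∧ a * a = X * a - 1 := by
    have h4 : 0 ≤ 1 - (X / 2) ^ 2 := by
      nlinarith [abs_le.1 hX, sq_abs X, abs_nonneg X]
    refine ⟨⟨X / 2, √(1 - (X / 2) ^ 2)⟩, ?_, ?_⟩
    · rw [Complex.norm_def, Complex.normSq_mk, Real.mul_self_sqrt h4]
      ring_nf
      exact Real.sqrt_one
    · apply Complex.ext
      · simp [Real.mul_self_sqrt h4]; ring
      · simp; ring
  set w : ℕ → ℝ := fun i => K * s ^ i * (2 * i + 3) with hw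
  have hw0 : ∀ i, 0 ≤ w i := fun i => by positivity
  have hws : Summable w := by
    have h1 := summable_pow_mul_geometric_of_norm_lt_one (R := ℝ) 1
      (r := s) (by rwa [Real.norm_eq_abs, abs_of_nonneg hs0])
    have h2 := summable_geometric_of_lt_one hs0 hs1
    refine ((h1.mul_left (2 * K)).add (h2.mul_left (3 * K))).congr fun i => ?_
    simp only [hw, pow_one]; ring
  have hM0 : 0 ≤ M := le_trans (by positivity) hM
  set T : ℕ → ℝ := fun n => M * ∏ i ∈ Finset.range n, (1 + w i) with hT
  have hT0 : ∀ n, 0 ≤ T n := fun n =>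
    mul_nonneg hM0 (Finset.prod_nonneg fun i _ => by linarith [hw0 i])
  have hTs : ∀ n, T (n + 1) = T n * (1 + w n) := fun n => by
    simp only [hT, Finset.prod_range_succ]; ring
  have hTm : ∀ n, T n ≤ T (n + 1) := fun n => by
    rw [hTs]; nlinarith [mul_nonneg (hT0 n) (hw0 n)]
  have main : ∀ n : ℕ, |u n| ≤ (n + 1) * T n ∧ ‖(u (n + 1) : ℂ) - a * u n‖ ≤ T n := by
    intro n
    induction n with
    | zero =>
      have : T 0 = M := by simp [hT]
      rw [this]
      constructor
      · push_cast; linarith [abs_nonneg (u 1)]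
      · refine (norm_sub_le _ _).trans ?_
        rw [norm_mul, ha1, Complex.norm_real, Complex.norm_real, Real.norm_eq_abs,
          Real.norm_eq_abs]
        simp only [zero_add]
        linarith
    | succ n ih =>
      obtain ⟨h1, h2⟩ := ih
      have h3 : |u (n + 1)| ≤ (n + 2) * T n := by
        have : ‖(u (n + 1) : ℂ)‖ ≤ ‖(u (n + 1) : ℂ) - a * u n‖ + ‖a * u n‖ := by
          simpa using norm_add_le ((u (n + 1) : ℂ) - a * u n) (a * u n)
        rw [norm_mul, ha1, Complex.norm_real, Complex.norm_real, Real.norm_eq_abs,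
          Real.norm_eq_abs] at this
        linarith
      constructor
      · push_cast
        have := hTm n
        nlinarith [hT0 n, hT0 (n + 1)]
      · have e1 : (u (n + 1 + 1) : ℂ) - a * u (n + 1) =
            (starRingEnd ℂ a) * (u (n + 1) - a * u n) + (e n * u (n + 1) + d n * u n : ℝ) := by
          have hc : (starRingEnd ℂ a) * a = 1 := by
            rw [mul_comm, Complex.mul_conj, Complex.normSq_eq_norm_sq, ha1]; simp
          have hX' : (X : ℂ) = a + starRingEnd ℂ a := by
            linear_combination -(starRingEnd ℂ a) * ha - (X - a) * hc
          rw [hu]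
          push_cast
          rw [hX']
          linear_combination (u n : ℂ) * hc
        rw [e1]
        refine (norm_add_le _ _).trans ?_
        rw [norm_mul, Complex.norm_conj, ha1, one_mul, Complex.norm_real, Real.norm_eq_abs]
        have h4 : |e n * u (n + 1) + d n * u n| ≤ K * s ^ n * ((n + 2) * T n)
            + K * s ^ n * ((n + 1) * T n) := by
          refine (abs_add_le _ _).trans ?_
          rw [abs_mul, abs_mul]
          gcongr
          exacts [he n, hd n]
        rw [hTs]
        simp only [hw]
        linarith
  refine (main n).1.trans ?_
  have h5 : ∏ i ∈ Finset.range n, (1 + w i) ≤ Real.exp (∑' i, w i) :=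
    (Real.prod_one_add_le_exp_sum _ hw0).trans
      (Real.exp_le_exp.2 (hws.sum_le_tsum _ fun i _ => hw0 i))
  exact mul_le_mul_of_nonneg_left (mul_le_mul_of_nonneg_left h5 hM0) (by positivity)

theorem exists_qPoch_lower_bound {q a₀ : ℝ} (hq : |q| < 1) (ha₀ : a₀ < 1) :
    ∃ c > 0, ∀ a, |a| ≤ a₀ → ∀ n, c ≤ qPoch a q n := by
  refine ⟨Real.exp (-(a₀ / (1 - a₀) * (1 - |q|)⁻¹)), Real.exp_pos _, fun a ha n => ?_⟩
  have h0 : 0 ≤ a₀ := (abs_nonneg a).trans ha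
  have h1 : 0 < 1 - a₀ := by linarith
  have hfac : ∀ i : ℕ, Real.exp (-(a₀ / (1 - a₀) * |q| ^ i)) ≤ 1 - a * q ^ i := by
    intro i
    have hp : |q| ^ i ≤ 1 := pow_le_one₀ (abs_nonneg q) hq.le
    set t := a₀ * |q| ^ i with ht
    have ht0 : 0 ≤ t := by positivity
    have ht1 : t ≤ a₀ := mul_le_of_le_one_right h0 hp
    have hat : a * q ^ i ≤ t := by
      refine (le_abs_self _).trans ?_
      rw [abs_mul, abs_pow]
      exact mul_le_mul_of_nonneg_right ha (by positivity)
    have ez : a₀ / (1 - a₀) * |q| ^ i = t / (1 - a₀) := by rw [ht]; ring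
    rw [ez, Real.exp_neg]
    have hz := Real.add_one_le_exp (t / (1 - a₀))
    have hz0 : 0 ≤ t / (1 - a₀) := by positivity
    refine le_trans ?_ (by linarith : 1 - t ≤ 1 - a * q ^ i)
    rw [inv_le_iff_one_le_mul₀ (Real.exp_pos _)]
    have e1 : t / (1 - a₀) * (1 - a₀) = t := div_mul_cancel₀ _ h1.ne'
    nlinarith [mul_le_mul_of_nonneg_left ht1 hz0]
  calc Real.exp (-(a₀ / (1 - a₀) * (1 - |q|)⁻¹))
      ≤ Real.exp (∑ i ∈ Finset.range n, -(a₀ / (1 - a₀) * |q| ^ i)) := by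
        rw [Real.exp_le_exp, Finset.sum_neg_distrib, ← Finset.mul_sum, neg_le_neg_iff]
        refine mul_le_mul_of_nonneg_left ?_ (by positivity)
        rw [← tsum_geometric_of_lt_one (abs_nonneg q) hq]
        exact (summable_geometric_of_lt_one (abs_nonneg q) hq).sum_le_tsum _
          fun i _ => by positivity
    _ = ∏ i ∈ Finset.range n, Real.exp (-(a₀ / (1 - a₀) * |q| ^ i)) := Real.exp_sum _ _
    _ ≤ qPoch a q n := Finset.prod_le_prod (fun i _ => (Real.exp_pos _).le) fun i _ => hfac i

theorem exists_hermite_bound {q : ℝ} (hq : |q| < 1) :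
    ∃ C ≥ 0, ∀ X, |X| ≤ 2 → ∀ n : ℕ, |hermite q X n| ≤ C * (n + 1) := by
  refine ⟨3 * Real.exp (∑' i : ℕ, 1 * |q| ^ i * (2 * i + 3)), by positivity, fun X hX n => ?_⟩
  rw [mul_comm]
  refine abs_le_of_perturbed_chebyshev (e := 0) (d := fun n => q ^ (n + 1)) hX zero_le_one
    (abs_nonneg q) hq (fun n => ?_) (fun n => ?_) (fun n => ?_) ?_ n
  · simp only [hermite, Pi.zero_apply]; ring
  · simp only [Pi.zero_apply, abs_zero]; positivity
  · rw [abs_pow, one_mul]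
    exact pow_le_pow_of_le_one (abs_nonneg q) hq.le (Nat.le_succ n)
  · simp only [hermite, abs_one]; linarith

theorem exists_chihara_bound {q : ℝ} (hq : |q| < 1) :
    ∃ C ≥ 0, ∀ r X Y, |r| ≤ 1 → |X| ≤ 2 → |Y| ≤ 2 → ∀ n : ℕ,
      |chihara q r X Y n| ≤ C * (n + 1) := by
  refine ⟨5 * Real.exp (∑' i : ℕ, 3 * |q| ^ i * (2 * i + 3)), by positivity,
    fun r X Y hr hX hY n => ?_⟩
  have hrY : |r * Y| ≤ 2 := by
    rw [abs_mul]; nlinarith [abs_nonneg r, abs_nonneg Y]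
  have hr2 : |r ^ 2| ≤ 1 := by
    rw [abs_pow]; exact pow_le_one₀ (abs_nonneg r) hr
  have hqn : ∀ m n : ℕ, n ≤ m → |q ^ m| ≤ |q| ^ n := fun m n h => by
    rw [abs_pow]; exact pow_le_pow_of_le_one (abs_nonneg q) hq.le h
  rw [mul_comm]
  refine abs_le_of_perturbed_chebyshev (e := fun n => -(r * Y * q ^ (n + 1)))
    (d := fun n => q ^ (n + 1) + r ^ 2 * q ^ n + -(r ^ 2 * q ^ (2 * n + 1))) hX
    (by norm_num) (abs_nonneg q) hq (fun n => ?_) (fun n => ?_) (fun n => ?_) ?_ n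
  · simp only [chihara]; ring
  · rw [abs_neg, abs_mul]
    have := hqn (n + 1) n (by omega)
    have : 0 ≤ |q| ^ n := by positivity
    nlinarith [abs_nonneg (q ^ (n + 1)), abs_nonneg (r * Y)]
  · refine (abs_add_three _ _ _).trans ?_
    rw [abs_neg, abs_mul, abs_mul (r ^ 2)]
    have h1 := hqn (n + 1) n (by omega)
    have h2 := hqn n n le_rfl
    have h3 := hqn (2 * n + 1) n (by omega)
    have h4 : |r ^ 2| * |q ^ n| ≤ |q ^ n| := mul_le_of_le_one_left (abs_nonneg _) hr2
    have h5 : |r ^ 2| * |q ^ (2 * n + 1)| ≤ |q ^ (2 * n + 1)| :=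
      mul_le_of_le_one_left (abs_nonneg _) hr2
    linarith
  · simp only [chihara, abs_one]
    linarith [abs_sub X (r * Y)]

theorem exists_dualHermite_bound {q : ℝ} (hq : |q| < 1) :
    ∃ C ≥ 0, ∀ Y, |Y| ≤ 2 → ∀ n : ℕ, |dualHermite q Y n| ≤ C := by
  set w : ℕ → ℝ := fun i => 4 * |q| ^ i with hw
  have hw0 : ∀ i, 0 ≤ w i := fun i => by positivity
  have hws : Summable w := (summable_geometric_of_lt_one (abs_nonneg q) hq).mul_left 4
  refine ⟨2 * Real.exp (∑' i, w i), by positivity, fun Y hY n => ?_⟩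
  set T : ℕ → ℝ := fun n => 2 * ∏ i ∈ Finset.range n, (1 + w i) with hT
  have hT0 : ∀ n, 0 ≤ T n := fun n =>
    mul_nonneg zero_le_two (Finset.prod_nonneg fun i _ => by linarith [hw0 i])
  have hTs : ∀ n, T (n + 1) = T n * (1 + w n) := fun n => by
    simp only [hT, Finset.prod_range_succ]; ring
  have main : ∀ n : ℕ, |dualHermite q Y n| ≤ T n ∧ |dualHermite q Y (n + 1)| ≤ T n := by
    intro n
    induction n with
    | zero => simpa [hT, dualHermite] using hY
    | succ n ih =>
      have hm : T n ≤ T (n + 1) := by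
        rw [hTs]; nlinarith [mul_nonneg (hT0 n) (hw0 n)]
      refine ⟨ih.2.trans hm, ?_⟩
      have hp : 0 ≤ |q| ^ n := by positivity
      have h1 : |q| ^ (n + 1) ≤ |q| ^ n :=
        pow_le_pow_of_le_one (abs_nonneg q) hq.le (Nat.le_succ n)
      have h2 : |1 - q ^ (n + 1)| ≤ 2 := by
        refine (abs_sub _ _).trans ?_
        rw [abs_one, abs_pow]
        linarith [pow_le_one₀ (abs_nonneg q) hq.le (n := n + 1)]
      have h3 : |dualHermite q Y (n + 1 + 1)| ≤ |q| ^ n * 2 * T n + |q| ^ n * 2 * T n := by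
        rw [dualHermite]
        refine (abs_add_le _ _).trans ?_
        simp only [abs_mul, abs_neg, abs_pow]
        gcongr
        exacts [ih.2, ih.1]
      refine h3.trans ?_
      rw [hTs]
      simp only [hw]
      linarith [hT0 n]
  refine (main n).1.trans (mul_le_mul_of_nonneg_left ?_ zero_le_two)
  exact (Real.prod_one_add_le_exp_sum _ hw0).trans
      (Real.exp_le_exp.2 (hws.sum_le_tsum _ fun i _ => hw0 i))

theorem exists_kernelTerm_bound {q : ℝ} (hq : |q| < 1) :
    ∃ C ≥ 0, ∀ r X Y, |X| ≤ 2 → |Y| ≤ 2 → ∀ n : ℕ,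
      |kernelTerm q r X Y n| ≤ C * (n + 1) ^ 2 * |r| ^ n := by
  obtain ⟨C, hC, hH⟩ := exists_hermite_bound hq
  obtain ⟨c, hc, hP⟩ := exists_qPoch_lower_bound hq hq
  refine ⟨C ^ 2 / c, by positivity, fun r X Y hX hY n => ?_⟩
  have h1 := hP q le_rfl n
  have h2 : 0 < qPoch q q n := hc.trans_le h1
  rw [kernelTerm, abs_mul, abs_mul, abs_div, abs_pow, abs_of_pos h2]
  calc |r| ^ n / qPoch q q n * |hermite q Y n| * |hermite q X n|
      ≤ |r| ^ n / c * (C * (n + 1)) * (C * (n + 1)) := by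
        gcongr
        exacts [hH Y hY n, hH X hX n]
    _ = _ := by ring

theorem exists_dualCoeff_bound {q r₀ : ℝ} (hq : |q| < 1) (hr₀ : r₀ < 1) :
    ∃ C ≥ 0, ∀ r Y, |r| ≤ r₀ → |Y| ≤ 2 → ∀ n : ℕ, |dualCoeff q r Y n| ≤ C * |r| ^ n := by
  obtain ⟨C, hC, hB⟩ := exists_dualHermite_bound hq
  obtain ⟨c, hc, hP⟩ := exists_qPoch_lower_bound hq hq
  obtain ⟨c', hc', hP'⟩ := exists_qPoch_lower_bound hq hr₀
  refine ⟨C / (c' * c), by positivity, fun r Y hr hY n => ?_⟩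
  have h1 := hP q le_rfl n
  have hr2 : |r ^ 2| ≤ r₀ := by
    rw [abs_pow]; nlinarith [abs_nonneg r]
  have h2 := hP' (r ^ 2) hr2 n
  have h3 : 0 < qPoch (r ^ 2) q n * qPoch q q n :=
    mul_pos (hc'.trans_le h2) (hc.trans_le h1)
  rw [dualCoeff, abs_mul, abs_div, abs_pow, abs_of_pos h3]
  calc |r| ^ n / (qPoch (r ^ 2) q n * qPoch q q n) * |dualHermite q Y n|
      ≤ |r| ^ n / (c' * c) * C := by
        gcongr
        exacts [(hc'.trans_le h2).le, hB Y hY n]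
    _ = _ := by ring

theorem exists_dualTerm_bound {q r₀ : ℝ} (hq : |q| < 1) (hr₀ : r₀ < 1) :
    ∃ C ≥ 0, ∀ r X Y, |r| ≤ r₀ → |X| ≤ 2 → |Y| ≤ 2 → ∀ n : ℕ,
      |dualTerm q r X Y n| ≤ C * (n + 1) ^ 2 * |r| ^ n := by
  obtain ⟨C, hC, hp⟩ := exists_chihara_bound hq
  obtain ⟨D, hD, hd⟩ := exists_dualCoeff_bound hq hr₀
  refine ⟨D * C, by positivity, fun r X Y hr hX hY n => ?_⟩
  rw [dualTerm, abs_mul]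
  have h1 : (n + 1 : ℝ) ≤ (n + 1) ^ 2 := by nlinarith [(Nat.cast_nonneg n : (0 : ℝ) ≤ n)]
  calc |dualCoeff q r Y n| * |chihara q r X Y n| ≤ (D * |r| ^ n) * (C * (n + 1)) := by
        gcongr
        exacts [hd r Y hr hY n, hp r X Y (hr.trans hr₀.le) hX hY n]
    _ ≤ (D * |r| ^ n) * (C * (n + 1) ^ 2) := by gcongr
    _ = _ := by ring

theorem summable_bound (C : ℝ) {r : ℝ} (hr : |r| < 1) :
    Summable fun n : ℕ => C * (n + 1 : ℝ) ^ 2 * |r| ^ n := by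
  have hn : ‖|r|‖ < 1 := by rwa [Real.norm_eq_abs, abs_abs]
  have h := fun k => summable_pow_mul_geometric_of_norm_lt_one (R := ℝ) k hn
  refine (((h 2).mul_left C).add (((h 1).mul_left (2 * C)).add ((h 0).mul_left C))).congr
    fun n => ?_
  ring

/-! ### Product formulas for the two series -/

/-- If the `n`-th term is `O(|r| ^ n)` with summable constants and the zeroth term is `1`, then the
sum tends to `1` along `r q ^ k → 0`. -/
theorem tendsto_tsum_one {q r C : ℝ} (hq : |q| < 1) (hr : |r| < 1) (hC : 0 ≤ C)
    {f : ℕ → ℕ → ℝ} (h0 : ∀ k, f k 0 = 1)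
    (hf : ∀ k n, |f k n| ≤ C * (n + 1) ^ 2 * |q ^ k * r| ^ n) :
    Tendsto (fun k => ∑' n, f k n) atTop (𝓝 1) := by
  have hle : ∀ k : ℕ, |q ^ k * r| ≤ |r| := fun k => by
    rw [abs_mul, abs_pow]
    exact mul_le_of_le_one_left (abs_nonneg r) (pow_le_one₀ (abs_nonneg q) hq.le)
  have ht : Tendsto (fun k : ℕ => |q ^ k * r|) atTop (𝓝 0) := by
    have := ((tendsto_pow_atTop_nhds_zero_of_abs_lt_one hq).mul_const r).abs
    simpa using this
  have h1 : (1 : ℝ) = ∑' n : ℕ, if n = 0 then (1 : ℝ) else 0 := by simp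
  rw [h1]
  refine tendsto_tsum_of_dominated_convergence (summable_bound C hr) (fun n => ?_)
    (Eventually.of_forall fun k n => ?_)
  · rcases n with _ | n
    · simp [h0]
    · simp only [Nat.succ_ne_zero, if_false]
      refine squeeze_zero_norm (fun k => hf k _) ?_
      have := (ht.pow (n + 1)).const_mul (C * ((n + 1 : ℕ) + 1 : ℝ) ^ 2)
      simpa using this
  · refine (hf k n).trans ?_
    exact mul_le_mul_of_nonneg_left (pow_le_pow_left₀ (abs_nonneg _) (hle k) n) (by positivity)


theorem multipliable_qPoch {q : ℝ} (hq : |q| < 1) (a : ℝ) :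
    Multipliable fun i : ℕ => 1 - a * q ^ i := by
  have h : Summable fun i : ℕ => -(a * q ^ i) :=
    ((summable_geometric_of_abs_lt_one hq).mul_left a).neg
  simpa only [sub_eq_add_neg] using Real.multipliable_one_add_of_summable h

theorem tendsto_qPoch {q : ℝ} (hq : |q| < 1) (a : ℝ) :
    Tendsto (qPoch a q) atTop (𝓝 (qPochInf a q)) :=
  (multipliable_qPoch hq a).hasProd.tendsto_prod_nat

theorem qPoch_pos {q a : ℝ} (hq : |q| < 1) (ha : |a| < 1) (n : ℕ) : 0 < qPoch a q n := by
  obtain ⟨c, hc, h⟩ := exists_qPoch_lower_bound hq ha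
  exact hc.trans_le (h a le_rfl n)

theorem qPochInf_pos {q a : ℝ} (hq : |q| < 1) (ha : |a| < 1) : 0 < qPochInf a q := by
  obtain ⟨c, hc, h⟩ := exists_qPoch_lower_bound hq ha
  exact hc.trans_le (ge_of_tendsto' (tendsto_qPoch hq a) (h a le_rfl))

theorem abs_sq_lt_one {r : ℝ} (hr : |r| < 1) : |r ^ 2| < 1 := by
  rw [abs_pow]
  exact pow_lt_one₀ (abs_nonneg r) hr two_ne_zero

theorem abs_pow_mul_le {q : ℝ} (hq : |q| < 1) (r : ℝ) (k : ℕ) : |q ^ k * r| ≤ |r| := by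
  rw [abs_mul, abs_pow]
  exact mul_le_of_le_one_left (abs_nonneg r) (pow_le_one₀ (abs_nonneg q) hq.le)

theorem multipliable_quartic {q r : ℝ} (hq : |q| < 1) (X Y : ℝ) :
    Multipliable fun k : ℕ => quartic (q ^ k * r) X Y := by
  have h : ∀ m : ℕ, 1 ≤ m → Summable fun k : ℕ => (q ^ k * r) ^ m := fun m hm => by
    have hqm : |q ^ m| < 1 := by
      rw [abs_pow]; exact pow_lt_one₀ (abs_nonneg q) hq (by omega)
    refine ((summable_geometric_of_abs_lt_one hqm).mul_right (r ^ m)).congr fun k => ?_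
    ring
  have hs : Summable fun k : ℕ => -(X * Y) * (q ^ k * r) ^ 1
      + ((X ^ 2 + Y ^ 2 - 2) * (q ^ k * r) ^ 2 + (-(X * Y) * (q ^ k * r) ^ 3
      + (q ^ k * r) ^ 4)) :=
    ((h 1 (by norm_num)).mul_left _).add (((h 2 (by norm_num)).mul_left _).add
      (((h 3 (by norm_num)).mul_left _).add (h 4 (by norm_num))))
  refine (Real.multipliable_one_add_of_summable hs).congr fun k => ?_
  unfold quartic
  ring

theorem summable_kernelTerm {q r X Y : ℝ} (hq : |q| < 1) (hr : |r| < 1) (hX : |X| ≤ 2)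
    (hY : |Y| ≤ 2) : Summable (kernelTerm q r X Y) := by
  obtain ⟨C, -, h⟩ := exists_kernelTerm_bound hq
  exact Summable.of_norm_bounded (summable_bound C hr) (h r X Y hX hY)

theorem summable_dualTerm {q r X Y : ℝ} (hq : |q| < 1) (hr : |r| < 1) (hX : |X| ≤ 2)
    (hY : |Y| ≤ 2) : Summable (dualTerm q r X Y) := by
  obtain ⟨C, -, h⟩ := exists_dualTerm_bound hq hr
  exact Summable.of_norm_bounded (summable_bound C hr) (h r X Y le_rfl hX hY)

/-- The `q`-difference equation of the reciprocal series. -/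
theorem quartic_mul_tsum_dualTerm {q r X Y : ℝ} (hq : |q| < 1) (hr : |r| < 1) (hX : |X| ≤ 2)
    (hY : |Y| ≤ 2) :
    quartic r X Y * ∑' n, dualTerm q (q * r) X Y n =
      (1 - r ^ 2) * (1 - r ^ 2 * q) * ∑' n, dualTerm q r X Y n := by
  have hle : |q * r| ≤ |r| := by simpa using abs_pow_mul_le hq r 1
  have hqr : |q * r| < 1 := hle.trans_lt hr
  have s1 := (summable_dualTerm hq hr hX hY).hasSum
  have s2 := (summable_dualTerm hq hqr hX hY).hasSum
  have hL := (((s2.mul_left (quartic r X Y)).sub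
    (s1.mul_left ((1 - r ^ 2) * (1 - r ^ 2 * q)))).tendsto_sum_nat).comp (tendsto_add_atTop_nat 1)
  have hR : Tendsto (fun N : ℕ => r ^ 2 * (dualCoeff q (q * r) Y N * chihara q r X Y (N + 2))
      + (1 - r ^ 2) * (1 - r ^ 2 * q) * (1 - q ^ (N + 1)) * dualTerm q r X Y (N + 1))
      atTop (𝓝 0) := by
    have t1 : Tendsto (fun N : ℕ => dualCoeff q (q * r) Y N * chihara q r X Y (N + 2))
        atTop (𝓝 0) := by
      obtain ⟨C, hC, hp⟩ := exists_chihara_bound hq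
      obtain ⟨D, hD, hd⟩ := exists_dualCoeff_bound hq hr
      refine squeeze_zero_norm (fun N => ?_)
        (summable_bound (3 * (D * C)) hqr).tendsto_atTop_zero
      rw [norm_mul]
      have hN : (0 : ℝ) ≤ N := Nat.cast_nonneg N
      calc ‖dualCoeff q (q * r) Y N‖ * ‖chihara q r X Y (N + 2)‖
          ≤ (D * |q * r| ^ N) * (C * ((N + 2 : ℕ) + 1)) :=
            mul_le_mul (hd _ Y hle hY N) (hp r X Y hr.le hX hY _) (norm_nonneg _)
              (by positivity)
        _ ≤ (D * |q * r| ^ N) * (C * (3 * (N + 1) ^ 2)) := by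
            refine mul_le_mul_of_nonneg_left (mul_le_mul_of_nonneg_left ?_ hC) (by positivity)
            push_cast
            nlinarith
        _ = _ := by ring
    have t2 := s1.summable.tendsto_atTop_zero.comp (tendsto_add_atTop_nat 1)
    have t3 := (tendsto_pow_atTop_nhds_zero_of_abs_lt_one hq).comp (tendsto_add_atTop_nat 1)
    have := (t1.const_mul (r ^ 2)).add
      (((t3.const_sub 1).const_mul ((1 - r ^ 2) * (1 - r ^ 2 * q))).mul t2)
    simpa [Function.comp_def] using this
  have hEq := fun N => sum_range_quartic_mul_dualTerm
    (fun n => (qPoch_pos hq hq n).ne') (fun n => (qPoch_pos hq (abs_sq_lt_one hr) n).ne') X Y N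
  have := tendsto_nhds_unique (hL.congr hEq) hR
  linarith

/-- Iterating `F (r) = (quartic r)⁻¹ (1 - r²)(1 - r² q) F (q r)` down to `r = 0`. -/
theorem prod_quartic_mul_tsum_kernelTerm {q r X Y : ℝ} (hq : |q| < 1) (hr : |r| < 1)
    (hX : |X| ≤ 2) (hY : |Y| ≤ 2) :
    (∏' k : ℕ, quartic (q ^ k * r) X Y) * ∑' n, kernelTerm q r X Y n = qPochInf (r ^ 2) q := by
  have hrk : ∀ k : ℕ, |q ^ k * r| < 1 := fun k => (abs_pow_mul_le hq r k).trans_lt hr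
  have iter : ∀ N : ℕ, (∏ k ∈ Finset.range N, quartic (q ^ k * r) X Y)
      * ∑' n, kernelTerm q r X Y n
      = qPoch (r ^ 2) q (2 * N) * ∑' n, kernelTerm q (q ^ N * r) X Y n := by
    intro N
    induction N with
    | zero => simp [qPoch_zero]
    | succ N ih =>
      have e : q ^ (N + 1) * r = q * (q ^ N * r) := by ring
      have hstep := quartic_mul_tsum_kernelTerm (fun n => (qPoch_pos hq hq n).ne')
        (summable_kernelTerm hq (hrk N) hX hY) (e ▸ summable_kernelTerm hq (hrk (N + 1)) hX hY)
      rw [Finset.prod_range_succ, e, mul_add_one, qPoch_succ, qPoch_succ]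
      linear_combination quartic (q ^ N * r) X Y * ih + qPoch (r ^ 2) q (2 * N) * hstep
  obtain ⟨C, hC, hb⟩ := exists_kernelTerm_bound hq
  have h1 : Tendsto (fun N => ∑' n, kernelTerm q (q ^ N * r) X Y n) atTop (𝓝 1) :=
    tendsto_tsum_one hq hr hC (fun k => by simp [kernelTerm, hermite, qPoch])
      fun k n => hb _ X Y hX hY n
  have h2 := ((tendsto_qPoch hq (r ^ 2)).comp
    (tendsto_id.const_mul_atTop' two_pos)).mul h1
  have h3 := ((multipliable_quartic (r := r) hq X Y).hasProd.tendsto_prod_nat).mul_const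
    (∑' n, kernelTerm q r X Y n)
  rw [mul_one] at h2
  exact tendsto_nhds_unique (h3.congr iter) h2

/-- Iterating `F (r) = quartic r * ((1 - r²)(1 - r² q))⁻¹ * F (q r)` down to `r = 0`. -/
theorem qPochInf_mul_tsum_dualTerm {q r X Y : ℝ} (hq : |q| < 1) (hr : |r| < 1)
    (hX : |X| ≤ 2) (hY : |Y| ≤ 2) :
    qPochInf (r ^ 2) q * ∑' n, dualTerm q r X Y n = ∏' k : ℕ, quartic (q ^ k * r) X Y := by
  have hrk : ∀ k : ℕ, |q ^ k * r| < 1 := fun k => (abs_pow_mul_le hq r k).trans_lt hr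
  have iter : ∀ N : ℕ, (∏ k ∈ Finset.range N, quartic (q ^ k * r) X Y)
      * ∑' n, dualTerm q (q ^ N * r) X Y n
      = qPoch (r ^ 2) q (2 * N) * ∑' n, dualTerm q r X Y n := by
    intro N
    induction N with
    | zero => simp [qPoch_zero]
    | succ N ih =>
      have e : q ^ (N + 1) * r = q * (q ^ N * r) := by ring
      have hstep := quartic_mul_tsum_dualTerm hq (hrk N) hX hY
      rw [Finset.prod_range_succ, e, mul_add_one, qPoch_succ, qPoch_succ]
      linear_combination (1 - (q ^ N * r) ^ 2) * (1 - (q ^ N * r) ^ 2 * q) * ih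
        + (∏ k ∈ Finset.range N, quartic (q ^ k * r) X Y) * hstep
  obtain ⟨C, hC, hb⟩ := exists_dualTerm_bound hq hr
  have h1 : Tendsto (fun N => ∑' n, dualTerm q (q ^ N * r) X Y n) atTop (𝓝 1) :=
    tendsto_tsum_one hq hr hC
      (fun k => by simp [dualTerm, dualCoeff, dualHermite, chihara, qPoch])
      fun k n => hb _ X Y (abs_pow_mul_le hq r k) hX hY n
  have h2 := ((tendsto_qPoch hq (r ^ 2)).comp
    (tendsto_id.const_mul_atTop' two_pos)).mul_const (∑' n, dualTerm q r X Y n)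
  have h3 := ((multipliable_quartic (r := r) hq X Y).hasProd.tendsto_prod_nat).mul h1
  rw [mul_one] at h3
  exact tendsto_nhds_unique h2 (h3.congr iter)

theorem tprod_quartic_ne_zero {q r X Y : ℝ} (hq : |q| < 1) (hr : |r| < 1)
    (hX : |X| ≤ 2) (hY : |Y| ≤ 2) : ∏' k : ℕ, quartic (q ^ k * r) X Y ≠ 0 := by
  refine left_ne_zero_of_mul (b := ∑' n, kernelTerm q r X Y n) ?_
  rw [prod_quartic_mul_tsum_kernelTerm hq hr hX hY]
  exact (qPochInf_pos hq (abs_sq_lt_one hr)).ne'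

theorem tsum_kernelTerm_mul_tsum_dualTerm {q r X Y : ℝ} (hq : |q| < 1) (hr : |r| < 1)
    (hX : |X| ≤ 2) (hY : |Y| ≤ 2) :
    (∑' n, kernelTerm q r X Y n) * ∑' n, dualTerm q r X Y n = 1 := by
  have hp := (qPochInf_pos hq (abs_sq_lt_one hr)).ne'
  have h1 := prod_quartic_mul_tsum_kernelTerm hq hr hX hY
  rw [← qPochInf_mul_tsum_dualTerm hq hr hX hY] at h1
  refine mul_left_cancel₀ hp ?_
  linear_combination h1


/-! ### The densities -/

theorem abs_sqrt_mul_le_two {q x : ℝ} (hq : |q| < 1) (hx : x ∈ S q) : |√(1 - q) * x| ≤ 2 := by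
  have h1 : 0 < √(1 - q) := Real.sqrt_pos.2 (by linarith [(abs_lt.1 hq).2])
  rw [S, Set.mem_Icc, neg_div, ← abs_le, le_div_iff₀ h1] at hx
  rwa [abs_mul, abs_of_pos h1, mul_comm]

theorem sqrt_sq_eq {q : ℝ} (hq : |q| < 1) : √(1 - q) ^ 2 = 1 - q :=
  Real.sq_sqrt (by linarith [(abs_lt.1 hq).2])

theorem sqrt_ne_zero {q : ℝ} (hq : |q| < 1) : √(1 - q) ≠ 0 :=
  (Real.sqrt_pos.2 (by linarith [(abs_lt.1 hq).2])).ne'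

theorem multipliable_numerator {q : ℝ} (hq : |q| < 1) (x : ℝ) :
    Multipliable fun k : ℕ => (1 + q ^ k) ^ 2 - (1 - q) * x ^ 2 * q ^ k := by
  have hq2 : |q ^ 2| < 1 := abs_sq_lt_one hq
  have hs : Summable fun k : ℕ => (2 - (1 - q) * x ^ 2) * q ^ k + (q ^ 2) ^ k :=
    ((summable_geometric_of_abs_lt_one hq).mul_left _).add (summable_geometric_of_abs_lt_one hq2)
  refine (Real.multipliable_one_add_of_summable hs).congr fun k => ?_
  ring

theorem fCN_eq_fN_mul {q r y x : ℝ} (hq : |q| < 1) (hr : |r| < 1) (hy : y ∈ S q) (hx : x ∈ S q) :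
    fCN q r y x = fN q x * ∑' n, mehlerTerm q r y x n := by
  have hX := abs_sqrt_mul_le_two hq hx
  have hY := abs_sqrt_mul_le_two hq hy
  have hs := sqrt_sq_eq hq
  rw [mehlerTerm_eq hs (sqrt_ne_zero hq)]
  have hW := tprod_quartic_ne_zero hq hr hX hY
  have hM := prod_quartic_mul_tsum_kernelTerm hq hr hX hY
  have hden : ∀ k : ℕ, (1 - r ^ 2 * q ^ (2 * k)) ^ 2
        - (1 - q) * r * q ^ k * (1 + r ^ 2 * q ^ (2 * k)) * x * y
        + (1 - q) * r ^ 2 * (x ^ 2 + y ^ 2) * q ^ (2 * k) =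
      quartic (q ^ k * r) (√(1 - q) * x) (√(1 - q) * y) := fun k => by
    rw [quartic]
    linear_combination (q ^ k * r * (1 + (q ^ k * r) ^ 2) * x * y
      - (q ^ k * r) ^ 2 * (x ^ 2 + y ^ 2)) * hs
  have hprod := (multipliable_numerator hq x).hasProd.mul
    ((multipliable_quartic (r := r) hq (√(1 - q) * x) (√(1 - q) * y)).hasProd.inv₀ hW)
  simp only [fCN, fN, hden]
  simp only [← div_eq_mul_inv] at hprod
  rw [hprod.tprod_eq, ← hM]
  generalize ∏' k : ℕ, quartic (q ^ k * r) (√(1 - q) * x) (√(1 - q) * y) = W at hW ⊢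
  field_simp

theorem fN_eq_fCN_mul {q r y x : ℝ} (hq : |q| < 1) (hr : |r| < 1) (hy : y ∈ S q) (hx : x ∈ S q) :
    fN q x = fCN q r y x * ∑' n, reciprocalTerm q r y x n := by
  have h := tsum_kernelTerm_mul_tsum_dualTerm hq hr (abs_sqrt_mul_le_two hq hx)
    (abs_sqrt_mul_le_two hq hy)
  rw [fCN_eq_fN_mul hq hr hy hx, mehlerTerm_eq (sqrt_sq_eq hq) (sqrt_ne_zero hq),
    reciprocalTerm_eq (sqrt_sq_eq hq) (sqrt_ne_zero hq), mul_assoc, h, mul_one]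

theorem exists_mehlerTerm_bound {q r : ℝ} (hq : |q| < 1) (hr : |r| < 1) :
    ∃ b : ℕ → ℝ, Summable b ∧ ∀ y ∈ S q, ∀ x ∈ S q, ∀ n, |mehlerTerm q r y x n| ≤ b n := by
  obtain ⟨C, -, h⟩ := exists_kernelTerm_bound hq
  refine ⟨_, summable_bound C hr, fun y hy x hx n => ?_⟩
  rw [mehlerTerm_eq (sqrt_sq_eq hq) (sqrt_ne_zero hq)]
  exact h r _ _ (abs_sqrt_mul_le_two hq hx) (abs_sqrt_mul_le_two hq hy) n

theorem exists_reciprocalTerm_bound {q r : ℝ} (hq : |q| < 1) (hr : |r| < 1) :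
    ∃ b : ℕ → ℝ, Summable b ∧ ∀ y ∈ S q, ∀ x ∈ S q, ∀ n, |reciprocalTerm q r y x n| ≤ b n := by
  obtain ⟨C, -, h⟩ := exists_dualTerm_bound hq hr
  refine ⟨_, summable_bound C hr, fun y hy x hx n => ?_⟩
  rw [reciprocalTerm_eq (sqrt_sq_eq hq) (sqrt_ne_zero hq)]
  exact h r _ _ le_rfl (abs_sqrt_mul_le_two hq hx) (abs_sqrt_mul_le_two hq hy) n

theorem measurable_fN {q : ℝ} (hq : |q| < 1) : Measurable (fN q) := by
  have h : Measurable fun x : ℝ =>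
      ∏' k : ℕ, ((1 + q ^ k) ^ 2 - (1 - q) * x ^ 2 * q ^ k) := by
    refine measurable_of_tendsto_metrizable
      (f := fun N x => ∏ k ∈ Finset.range N, ((1 + q ^ k) ^ 2 - (1 - q) * x ^ 2 * q ^ k))
      (fun N => by fun_prop) (tendsto_pi_nhds.2 fun x => ?_)
    exact (multipliable_numerator hq x).hasProd.tendsto_prod_nat
  unfold fN
  exact Measurable.mul (by fun_prop) h

/-- The zeroth factor `4 - (1 - q) x ^ 2` of the product absorbs the singularity of the prefactor
at the endpoints, so the density is bounded. -/
theorem exists_fN_bound {q : ℝ} (hq : |q| < 1) : ∃ C, ∀ x ∈ S q, |fN q x| ≤ C := by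
  set w : ℕ → ℝ := fun k => 7 * |q| ^ k with hw
  have hw0 : ∀ i, 0 ≤ w i := fun i => by positivity
  have hws : Summable w := (summable_geometric_of_lt_one (abs_nonneg q) hq).mul_left 7
  refine ⟨|√(1 - q) * qPochInf q q / (2 * Real.pi)| * (2 * Real.exp (∑' i, w i)),
    fun x hx => ?_⟩
  set X := √(1 - q) * x with hXdef
  have hX : |X| ≤ 2 := abs_sqrt_mul_le_two hq hx
  have hX2 : (1 - q) * x ^ 2 = X ^ 2 := by rw [hXdef, mul_pow, sqrt_sq_eq hq]
  have hX4 : X ^ 2 ≤ 4 := by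
    rw [← sq_abs]; nlinarith [abs_nonneg X]
  set z := 4 - X ^ 2 with hz
  have hz0 : 0 ≤ z := by linarith
  have hfac : ∀ k : ℕ, |(1 + q ^ k) ^ 2 - X ^ 2 * q ^ k| ≤ 1 + w k := fun k => by
    have h1 : |q ^ k| ≤ 1 := by rw [abs_pow]; exact pow_le_one₀ (abs_nonneg q) hq.le
    have e : (1 + q ^ k) ^ 2 - X ^ 2 * q ^ k = 1 + (2 - X ^ 2 + q ^ k) * q ^ k := by ring
    rw [e]
    refine (abs_add_le _ _).trans ?_
    have h2 : |2 - X ^ 2 + q ^ k| ≤ 7 := by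
      rw [abs_le] at h1 ⊢
      constructor <;> nlinarith [sq_nonneg X]
    rw [abs_one, abs_mul, abs_pow q k]
    simp only [hw]
    gcongr
  have hpart : ∀ N : ℕ,
      |∏ k ∈ Finset.range (N + 1), ((1 + q ^ k) ^ 2 - (1 - q) * x ^ 2 * q ^ k)|
        ≤ z * Real.exp (∑' i, w i) := by
    intro N
    simp only [hX2]
    rw [Finset.prod_range_succ', abs_mul, mul_comm, Finset.abs_prod]
    have e0 : (1 + q ^ 0) ^ 2 - X ^ 2 * q ^ 0 = z := by rw [hz]; ring
    rw [e0, abs_of_nonneg hz0]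
    refine mul_le_mul_of_nonneg_left ?_ hz0
    refine (Finset.prod_le_prod (fun _ _ => abs_nonneg _) fun k _ => hfac (k + 1)).trans ?_
    refine (Real.prod_one_add_le_exp_sum _ fun i => hw0 (i + 1)).trans (Real.exp_le_exp.2 ?_)
    refine (Summable.sum_le_tsum _ (fun i _ => hw0 (i + 1))
      ((summable_nat_add_iff 1).2 hws)).trans ?_
    rw [hws.tsum_eq_zero_add]
    linarith [hw0 0]
  have hlim : |∏' k : ℕ, ((1 + q ^ k) ^ 2 - (1 - q) * x ^ 2 * q ^ k)|
      ≤ z * Real.exp (∑' i, w i) :=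
    le_of_tendsto' (((multipliable_numerator hq x).hasProd.tendsto_prod_nat.comp
      (tendsto_add_atTop_nat 1)).abs) hpart
  have hsz : √z ≤ 2 := by
    rw [Real.sqrt_le_left zero_le_two]; nlinarith [sq_nonneg X]
  have e1 : fN q x = √(1 - q) * qPochInf q q / (2 * Real.pi) * ((√z)⁻¹ *
      ∏' k : ℕ, ((1 + q ^ k) ^ 2 - (1 - q) * x ^ 2 * q ^ k)) := by
    rw [fN, hX2, ← hz]; ring
  rw [e1, abs_mul]
  refine mul_le_mul_of_nonneg_left ?_ (abs_nonneg _)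
  rw [abs_mul, abs_of_nonneg (inv_nonneg.2 (Real.sqrt_nonneg z))]
  calc (√z)⁻¹ * |∏' k : ℕ, ((1 + q ^ k) ^ 2 - (1 - q) * x ^ 2 * q ^ k)|
      ≤ (√z)⁻¹ * (z * Real.exp (∑' i, w i)) := by gcongr
    _ = √z * Real.exp (∑' i, w i) := by
        rw [← mul_assoc, inv_mul_eq_div, Real.div_sqrt]
    _ ≤ _ := by gcongr

/-! ### Convergence in mean square -/

/-- On a finite measure space a series dominated termwise by a summable sequence of constants
converges in `L²`. -/
theorem memLp_and_tendsto_of_dominated {μ : Measure ℝ} [IsFiniteMeasure μ] {f : ℝ → ℝ}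
    {g : ℕ → ℝ → ℝ} {b : ℕ → ℝ} (hg : ∀ n, Continuous (g n)) (hb : Summable b)
    (h : ∀ᵐ x ∂μ, (∀ n, |g n x| ≤ b n) ∧ f x = ∑' n, g n x) :
    MemLp f 2 μ ∧ Tendsto (fun N : ℕ => eLpNorm
      (fun x => f x - ∑ n ∈ Finset.range N, g n x) 2 μ) atTop (𝓝 0) := by
  have hsum : ∀ x, (∀ n, |g n x| ≤ b n) → Summable fun n => g n x := fun x hx =>
    Summable.of_norm_bounded hb hx
  have htail : ∀ N : ℕ, ∀ᵐ x ∂μ, ‖f x - ∑ n ∈ Finset.range N, g n x‖ ≤ ∑' n, b (n + N) := by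
    intro N
    filter_upwards [h] with x hx
    have e : f x - ∑ n ∈ Finset.range N, g n x = ∑' n, g (n + N) x := by
      rw [hx.2, ← (hsum x hx.1).sum_add_tsum_nat_add N]; ring
    rw [e]
    exact tsum_of_norm_bounded ((summable_nat_add_iff N).2 hb).hasSum fun n => hx.1 (n + N)
  have hmeas : AEStronglyMeasurable f μ := by
    refine aestronglyMeasurable_of_tendsto_ae atTop
      (f := fun N x => ∑ n ∈ Finset.range N, g n x)
      (fun N => (continuous_finsetSum _ fun n _ => hg n).aestronglyMeasurable) ?_
    filter_upwards [h] with x hx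
    rw [hx.2]
    exact (hsum x hx.1).hasSum.tendsto_sum_nat
  refine ⟨MemLp.of_bound hmeas (∑' n, b (n + 0)) ?_, ?_⟩
  · simpa using htail 0
  · have hz : Tendsto (fun N : ℕ => μ Set.univ ^ ((2 : ENNReal).toReal)⁻¹
        * ENNReal.ofReal (∑' n, b (n + N))) atTop (𝓝 0) := by
      have h1 := ENNReal.tendsto_ofReal (tendsto_sum_nat_add b)
      rw [ENNReal.ofReal_zero] at h1
      have h2 := ENNReal.Tendsto.const_mul (a := μ Set.univ ^ ((2 : ENNReal).toReal)⁻¹) h1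
        (Or.inr (ENNReal.rpow_ne_top_of_nonneg (by positivity) (measure_ne_top μ _)))
      rwa [mul_zero] at h2
    exact tendsto_of_tendsto_of_tendsto_of_le_of_le tendsto_const_nhds hz
      (fun _ => zero_le) fun N => eLpNorm_le_of_ae_bound (htail N)

theorem isFiniteMeasure_withDensity_of_bound {q C : ℝ} {f : ℝ → ℝ}
    (hf : ∀ x ∈ S q, |f x| ≤ C) :
    IsFiniteMeasure ((volume.restrict (S q)).withDensity fun x => ENNReal.ofReal (f x)) := by
  refine isFiniteMeasure_withDensity (ne_of_lt ?_)
  calc ∫⁻ x in S q, ENNReal.ofReal (f x) ≤ ∫⁻ _ in S q, ENNReal.ofReal C := by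
        refine setLIntegral_mono measurable_const fun x hx => ?_
        exact ENNReal.ofReal_le_ofReal ((le_abs_self _).trans (hf x hx))
    _ < ⊤ := by
        rw [setLIntegral_const]
        exact ENNReal.mul_lt_top ENNReal.ofReal_lt_top isCompact_Icc.measure_lt_top

/-- The zeros of a density are null for the measure it defines. -/
theorem ae_withDensity_mem_and_ne_zero {q : ℝ} {f : ℝ → ℝ}
    (hf : AEMeasurable f (volume.restrict (S q))) :
    ∀ᵐ x ∂((volume.restrict (S q)).withDensity fun x => ENNReal.ofReal (f x)),
      x ∈ S q ∧ f x ≠ 0 := by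
  rw [ae_withDensity_iff' hf.ennreal_ofReal]
  filter_upwards [ae_restrict_mem measurableSet_Icc] with x hx h
  exact ⟨hx, fun h0 => h (by simp [h0])⟩

theorem continuous_H (q : ℝ) (n : ℕ) : Continuous fun x => H q x n := by
  induction n using Nat.twoStepInduction with
  | zero => simpa only [H] using continuous_const
  | one => simp only [H]; fun_prop
  | more n h0 h1 => simp only [H]; fun_prop

theorem continuous_P (q r y : ℝ) (n : ℕ) : Continuous fun x => P q r y x n := by
  induction n using Nat.twoStepInduction with
  | zero => simpa only [P] using continuous_const
  | one => simp only [P]; fun_prop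
  | more n h0 h1 => simp only [P]; fun_prop

theorem continuous_mehlerTerm (q r y : ℝ) (n : ℕ) :
    Continuous fun x => mehlerTerm q r y x n :=
  continuous_const.mul (continuous_H q n)

theorem continuous_reciprocalTerm (q r y : ℝ) (n : ℕ) :
    Continuous fun x => reciprocalTerm q r y x n :=
  continuous_const.mul (continuous_P q r y n)

theorem aemeasurable_fCN {q r y : ℝ} (hq : |q| < 1) (hr : |r| < 1) (hy : y ∈ S q) :
    AEMeasurable (fCN q r y) (volume.restrict (S q)) := by
  obtain ⟨b, hb, hle⟩ := exists_mehlerTerm_bound hq hr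
  refine aemeasurable_of_tendsto_metrizable_ae atTop
    (f := fun N x => fN q x * ∑ n ∈ Finset.range N, mehlerTerm q r y x n)
    (fun N => ((measurable_fN hq).mul (continuous_finsetSum _ fun n _ =>
      continuous_mehlerTerm q r y n).measurable).aemeasurable) ?_
  filter_upwards [ae_restrict_mem measurableSet_Icc] with x hx
  rw [fCN_eq_fN_mul hq hr hy hx]
  exact (Summable.of_norm_bounded hb (hle y hy x hx)).hasSum.tendsto_sum_nat.const_mul _

theorem exists_fCN_bound {q r y : ℝ} (hq : |q| < 1) (hr : |r| < 1) (hy : y ∈ S q) :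
    ∃ C, ∀ x ∈ S q, |fCN q r y x| ≤ C := by
  obtain ⟨b, hb, hle⟩ := exists_mehlerTerm_bound hq hr
  obtain ⟨C, hC⟩ := exists_fN_bound hq
  refine ⟨C * ∑' n, b n, fun x hx => ?_⟩
  rw [fCN_eq_fN_mul hq hr hy hx, abs_mul]
  exact mul_le_mul (hC x hx)
    (tsum_of_norm_bounded (f := mehlerTerm q r y x) hb.hasSum (hle y hy x hx)) (abs_nonneg _)
    ((abs_nonneg _).trans (hC x hx))

end QSeries

theorem mainTheorem3 (q ρ : ℝ) (hq : |q| < 1) (hρ : |ρ| < 1)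
    (y : ℝ) (hy : y ∈ QSeries.S q) :
    ((∀ x ∈ QSeries.S q,
        Summable (QSeries.mehlerTerm q ρ y x) ∧
        QSeries.fCN q ρ y x = QSeries.fN q x * ∑' n : ℕ, QSeries.mehlerTerm q ρ y x n) ∧
      MemLp (fun x => QSeries.fCN q ρ y x / QSeries.fN q x) 2 (QSeries.measureN q) ∧
      Tendsto
        (fun N : ℕ => eLpNorm
          (fun x => QSeries.fCN q ρ y x / QSeries.fN q x -
            ∑ n ∈ Finset.range N, QSeries.mehlerTerm q ρ y x n)
          2 (QSeries.measureN q))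
        atTop (𝓝 0)) ∧
    ((∀ x ∈ QSeries.S q,
        Summable (QSeries.reciprocalTerm q ρ y x) ∧
        QSeries.fN q x = QSeries.fCN q ρ y x * ∑' n : ℕ, QSeries.reciprocalTerm q ρ y x n) ∧
      MemLp (fun x => QSeries.fN q x / QSeries.fCN q ρ y x) 2 (QSeries.measureCN q ρ y) ∧
      Tendsto
        (fun N : ℕ => eLpNorm
          (fun x => QSeries.fN q x / QSeries.fCN q ρ y x -
            ∑ n ∈ Finset.range N, QSeries.reciprocalTerm q ρ y x n)
          2 (QSeries.measureCN q ρ y))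
        atTop (𝓝 0)) ∧
    (∀ x ∈ QSeries.S q,
      (∑' n : ℕ, QSeries.mehlerTerm q ρ y x n) *
        (∑' n : ℕ, QSeries.reciprocalTerm q ρ y x n) = 1) := by
  obtain ⟨b, hb, hle⟩ := QSeries.exists_mehlerTerm_bound hq hρ
  obtain ⟨b', hb', hle'⟩ := QSeries.exists_reciprocalTerm_bound hq hρ
  obtain ⟨C, hC⟩ := QSeries.exists_fN_bound hq
  obtain ⟨C', hC'⟩ := QSeries.exists_fCN_bound hq hρ hy
  have : IsFiniteMeasure (QSeries.measureN q) := QSeries.isFiniteMeasure_withDensity_of_bound hC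
  have : IsFiniteMeasure (QSeries.measureCN q ρ y) :=
    QSeries.isFiniteMeasure_withDensity_of_bound hC'
  refine ⟨⟨fun x hx => ⟨Summable.of_norm_bounded hb (hle y hy x hx),
      QSeries.fCN_eq_fN_mul hq hρ hy hx⟩, ?_⟩,
    ⟨fun x hx => ⟨Summable.of_norm_bounded hb' (hle' y hy x hx),
      QSeries.fN_eq_fCN_mul hq hρ hy hx⟩, ?_⟩, fun x hx => ?_⟩
  · refine QSeries.memLp_and_tendsto_of_dominated (g := fun n x => QSeries.mehlerTerm q ρ y x n)
      (QSeries.continuous_mehlerTerm q ρ y) hb ?_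
    filter_upwards [QSeries.ae_withDensity_mem_and_ne_zero
      (QSeries.measurable_fN hq).aemeasurable] with x hx
    refine ⟨hle y hy x hx.1, ?_⟩
    rw [QSeries.fCN_eq_fN_mul hq hρ hy hx.1, mul_div_cancel_left₀ _ hx.2]
  · refine QSeries.memLp_and_tendsto_of_dominated
      (g := fun n x => QSeries.reciprocalTerm q ρ y x n)
      (QSeries.continuous_reciprocalTerm q ρ y) hb' ?_
    filter_upwards [QSeries.ae_withDensity_mem_and_ne_zero
      (QSeries.aemeasurable_fCN hq hρ hy)] with x hx
    refine ⟨hle' y hy x hx.1, ?_⟩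
    rw [QSeries.fN_eq_fCN_mul hq hρ hy hx.1, mul_div_cancel_left₀ _ hx.2]
  · rw [QSeries.mehlerTerm_eq (QSeries.sqrt_sq_eq hq) (QSeries.sqrt_ne_zero hq),
      QSeries.reciprocalTerm_eq (QSeries.sqrt_sq_eq hq) (QSeries.sqrt_ne_zero hq)]
    exact QSeries.tsum_kernelTerm_mul_tsum_dualTerm hq hρ (QSeries.abs_sqrt_mul_le_two hq hx)
      (QSeries.abs_sqrt_mul_le_two hq hy)
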